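/- Let $B$ be a Boolean algebra. An ultrafilter of $B$ is a maximal proper filter of $B$. The topological density $d(B)$ is the least cardinal $\kappa$ such that there is a family $\{D_\xi : \xi<\kappa\}$ of ultrafilters of $B$ with $\bigcup_{\xi<\kappa} D_\xi = B\setminus\{0\}$. The algebra $B$ satisfies the countable chain condition (ccc) if there is no uncountable set of pairwise disjoint elements of $B\setminus\{0\}$. Theorem (ZFC). For every uncountable cardinal $\mu$ there is a ccc Boolean algebra $B$ such that $d(B)=\mu$. -/

import Mathlib

universe u

/-- The countable chain condition for a Boolean algebra: there is no uncountable set of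
pairwise disjoint nonzero elements. -/
def BACountableChainCondition (B : Type u) [BooleanAlgebra B] : Prop :=
  ∀ A : Set B, (∀ a ∈ A, a ≠ ⊥) → A.Pairwise Disjoint → A.Countable

/-- An ultrafilter of a Boolean algebra: a filter which is maximal among the proper filters. -/
def IsBAUltrafilter {B : Type u} [BooleanAlgebra B] (D : Order.PFilter B) : Prop :=
  Maximal (fun G : Order.PFilter B => ⊥ ∉ G) D

/-- `CoveredByUltrafilters B κ`: there is a family of ultrafilters of `B`, indexed by a set of
cardinality `κ`, whose union is the set of all nonzero elements of `B`. -/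
def CoveredByUltrafilters (B : Type u) [BooleanAlgebra B] (κ : Cardinal.{u}) : Prop :=
  ∃ (ι : Type u) (D : ι → Order.PFilter B), Cardinal.mk ι = κ ∧
    (∀ i, IsBAUltrafilter (D i)) ∧ (⋃ i, (D i : Set B)) = {b : B | b ≠ ⊥}

/-- The topological density `d(B)`: the least `κ` such that `B \ {0}` is the union of a family
of `κ` many ultrafilters of `B`. -/
noncomputable def topologicalDensity (B : Type u) [BooleanAlgebra B] : Cardinal.{u} :=
  sInf {κ : Cardinal.{u} | CoveredByUltrafilters B κ}

/-! By Stone duality the problem becomes topological. For a compact totally disconnected Hausdorff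
space `X`, the value of `topologicalDensity` at `Clopens X` is the least size of a dense set, and
property (K) of `X` makes `Clopens X` ccc. So it suffices to build, for every infinite `κ`, such a
space with density exactly `κ`; `hasStoneSpaceOfDensity` does this by induction. Property (K) is
carried along because arbitrary products preserve it.

At `ℵ₀` the Cantor space works. At a limit, take a product of spaces of smaller densities:
projections of dense sets are dense, and Hewitt–Marczewski–Pondiczery bounds the density from above.

At a successor, let `Ω` have order type `κ⁺`. In `succSet` each array `s` selects the `α` with `y
(α, s)` true, and selected `α < β` force `v (α, β, s ↾ β)` into `s β α`. Were `κ` many points dense,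
enumerate them in type `κ` and inject each initial segment of `Ω` into `κ` by `e β`. Recursion on
`β` gives an `s` whose entry `s β α` is avoided by all points enumerated before `e β α`. Some point
selects `κ⁺` many `α` for `s`; a selected `β` above `κ` many of them would place `κ` many values `e
β α` below one bound in `κ`. A node records `s ↾ β` and no more: little enough for this recursion,
yet enough to keep conflicting constraints apart in the amalgamation `IsSuccBox.exists_common`. -/

open Cardinal Set TopologicalSpace

/-! ### The Δ-system lemma -/

section DeltaSystem

/-- If some `t` lies in uncountably many sets, delete it and use induction. Otherwise a countable
disjoint subfamily meets only countably many members, so a maximal one is uncountable. -/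
theorem exists_deltaSystem_of_card {ι E : Type*} [DecidableEq E] (n : ℕ) (F : ι → Finset E)
    (I : Set ι) (hI : ¬ I.Countable) (hn : ∀ i ∈ I, (F i).card = n) :
    ∃ J ⊆ I, ¬ J.Countable ∧ ∃ R : Finset E, ∀ i ∈ J, ∀ j ∈ J, i ≠ j → F i ∩ F j = R := by
  induction n generalizing F I with
  | zero =>
    refine ⟨I, Subset.rfl, hI, ∅, fun i hi j _ _ => ?_⟩
    rw [Finset.card_eq_zero.1 (hn i hi), Finset.empty_inter]
  | succ n ih =>
    by_cases h : ∃ t, ¬ {i ∈ I | t ∈ F i}.Countable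
    · obtain ⟨t, ht⟩ := h
      obtain ⟨J, hJ, hJc, R, hR⟩ := ih (fun i => (F i).erase t) _ ht (fun i hi => by
        rw [Finset.card_erase_of_mem hi.2, hn i hi.1, Nat.add_sub_cancel])
      refine ⟨J, fun i hi => (hJ hi).1, hJc, insert t R, fun i hi j hj hij => ?_⟩
      rw [← hR i hi j hj hij]
      have h1 := (hJ hi).2
      have h2 := (hJ hj).2
      ext x
      by_cases hx : x = t
      · subst hx; simp [h1, h2]
      · simp [hx]
    · push Not at h
      obtain ⟨J, hJm⟩ := zorn_subset
        {J : Set ι | J ⊆ I ∧ J.Pairwise fun i j => Disjoint (F i) (F j)} (by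
          intro c hc hch
          refine ⟨⋃₀ c, ⟨sUnion_subset fun s hs => (hc hs).1, ?_⟩, fun s hs => subset_sUnion_of_mem hs⟩
          exact (pairwise_sUnion hch.directedOn).2 fun s hs => (hc hs).2)
      refine ⟨J, hJm.prop.1, fun hJc => ?_, ∅, fun i hi j hj hij =>
        Finset.disjoint_iff_inter_eq_empty.1 (hJm.prop.2 hi hj hij)⟩
      have hbad : (J ∪ ⋃ j ∈ J, ⋃ t ∈ F j, {i ∈ I | t ∈ F i}).Countable :=
        hJc.union (hJc.biUnion fun j _ => (F j).countable_toSet.biUnion fun t _ => h t)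
      obtain ⟨i, hi, hib⟩ : ∃ i ∈ I, i ∉ J ∪ ⋃ j ∈ J, ⋃ t ∈ F j, {i ∈ I | t ∈ F i} := by
        by_contra! hcon
        exact hI (hbad.mono hcon)
      have hdis : ∀ j ∈ J, Disjoint (F i) (F j) := by
        intro j hj
        rw [Finset.disjoint_left]
        intro t hti htj
        refine hib (Or.inr ?_)
        simp only [mem_iUnion]
        exact ⟨j, hj, t, htj, hi, hti⟩
      refine hib (Or.inl (hJm.le_of_ge ⟨insert_subset hi hJm.prop.1, ?_⟩ (subset_insert i J)
        (mem_insert i J)))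
      exact pairwise_insert.2
        ⟨hJm.prop.2, fun j hj _ => ⟨hdis j hj, (hdis j hj).symm⟩⟩

theorem exists_uncountable_fiber {ι β : Type*} [Countable β] (f : ι → β) {I : Set ι}
    (hI : ¬ I.Countable) : ∃ b, ¬ {i ∈ I | f i = b}.Countable := by
  by_contra! h
  refine hI ((countable_iUnion h).mono fun i hi => ?_)
  exact mem_iUnion.2 ⟨f i, hi, rfl⟩

/-- The Δ-system lemma for uncountable families of finite sets. -/
theorem exists_deltaSystem {ι E : Type*} [DecidableEq E] (F : ι → Finset E) (I : Set ι)
    (hI : ¬ I.Countable) :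
    ∃ J ⊆ I, ¬ J.Countable ∧ ∃ R : Finset E, ∀ i ∈ J, ∀ j ∈ J, i ≠ j → F i ∩ F j = R := by
  obtain ⟨n, hn⟩ := exists_uncountable_fiber (fun i => (F i).card) hI
  obtain ⟨J, hJ, h⟩ := exists_deltaSystem_of_card n F _ hn fun i hi => hi.2
  exact ⟨J, fun i hi => (hJ hi).1, h⟩

end DeltaSystem

/-! ### Property (K) and products -/

section PropertyK

/-- Property (K) of a topological space: every uncountable family of nonempty open sets has an
uncountable subfamily any two members of which meet. -/
def PropertyK (X : Type u) [TopologicalSpace X] : Prop :=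
  ∀ (ι : Type u) (W : ι → Set X) (I : Set ι), ¬ I.Countable →
    (∀ i ∈ I, IsOpen (W i) ∧ (W i).Nonempty) →
    ∃ J ⊆ I, ¬ J.Countable ∧ ∀ i ∈ J, ∀ j ∈ J, (W i ∩ W j).Nonempty

theorem IsOpen.exists_box {T : Type*} {X : T → Type*} [∀ t, TopologicalSpace (X t)]
    {W : Set (∀ t, X t)} (hW : IsOpen W) {z : ∀ t, X t} (hz : z ∈ W) :
    ∃ (Q : Finset T) (O : ∀ t, Set (X t)), (∀ t, IsOpen (O t) ∧ z t ∈ O t) ∧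
      ∀ z' : ∀ t, X t, (∀ t ∈ Q, z' t ∈ O t) → z' ∈ W := by
  classical
  obtain ⟨Q, O, hO, hsub⟩ := isOpen_pi_iff.1 hW z hz
  refine ⟨Q, fun t => if t ∈ Q then O t else univ, fun t => ?_, fun z' hz' => hsub ?_⟩
  · by_cases ht : t ∈ Q
    · simpa [ht] using hO t ht
    · simp [ht]
  · intro t ht
    simpa only [if_pos (Finset.mem_coe.1 ht)] using hz' t ht

theorem PropertyK.exists_finset {T : Type*} {X : T → Type u} [∀ t, TopologicalSpace (X t)]
    (hX : ∀ t, PropertyK (X t)) {ι : Type u} (O : ι → ∀ t, Set (X t)) {I : Set ι}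
    (hI : ¬ I.Countable) (hO : ∀ i ∈ I, ∀ t, IsOpen (O i t) ∧ (O i t).Nonempty) (R : Finset T) :
    ∃ J ⊆ I, ¬ J.Countable ∧ ∀ t ∈ R, ∀ i ∈ J, ∀ j ∈ J, (O i t ∩ O j t).Nonempty := by
  classical
  induction R using Finset.induction_on with
  | empty => exact ⟨I, Subset.rfl, hI, by simp⟩
  | insert t R _ ih =>
    obtain ⟨J, hJ, hJc, h⟩ := ih
    obtain ⟨J', hJ', hJc', h'⟩ := hX t ι (fun i => O i t) J hJc fun i hi => hO i (hJ hi) t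
    refine ⟨J', hJ'.trans hJ, hJc', fun t' ht' i hi j hj => ?_⟩
    rcases Finset.mem_insert.1 ht' with rfl | ht'
    · exact h' i hi j hj
    · exact h t' ht' i (hJ' hi) j (hJ' hj)

/-- Two boxes can conflict only on the root of a Δ-system of supports, and property (K) of these
finitely many factors removes the conflicts one coordinate at a time. -/
theorem PropertyK.pi {T : Type*} {X : T → Type u} [∀ t, TopologicalSpace (X t)]
    (hX : ∀ t, PropertyK (X t)) {ι : Type u} (W : ι → Set (∀ t, X t)) (I : Set ι)
    (hI : ¬ I.Countable) (hW : ∀ i ∈ I, IsOpen (W i) ∧ (W i).Nonempty) :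
    ∃ J ⊆ I, ¬ J.Countable ∧ ∀ i ∈ J, ∀ j ∈ J, (W i ∩ W j).Nonempty := by
  classical
  have hbox : ∀ i, ∃ (z : ∀ t, X t) (Q : Finset T) (O : ∀ t, Set (X t)), i ∈ I →
      (z ∈ W i ∧ (∀ t, IsOpen (O t) ∧ z t ∈ O t) ∧
        ∀ z' : ∀ t, X t, (∀ t ∈ Q, z' t ∈ O t) → z' ∈ W i) := by
    intro i
    by_cases hi : i ∈ I
    · obtain ⟨ho, z, hz⟩ := hW i hi
      obtain ⟨Q, O, h⟩ := ho.exists_box hz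
      exact ⟨z, Q, O, fun _ => ⟨hz, h⟩⟩
    · obtain ⟨j, hj⟩ : I.Nonempty := by
        by_contra h
        exact hI (by simp [not_nonempty_iff_eq_empty.1 h])
      exact ⟨(hW j hj).2.some, ∅, fun _ => univ, fun h => absurd h hi⟩
  choose z Q O h using hbox
  obtain ⟨J, hJ, hJc, R, hR⟩ := exists_deltaSystem Q I hI
  obtain ⟨J', hJ', hJc', hK⟩ := PropertyK.exists_finset hX O hJc
    (fun i hi t => ⟨((h i (hJ hi)).2.1 t).1, _, ((h i (hJ hi)).2.1 t).2⟩) R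
  refine ⟨J', hJ'.trans hJ, hJc', fun i hi j hj => ?_⟩
  have hiI := h i (hJ (hJ' hi))
  have hjI := h j (hJ (hJ' hj))
  rcases eq_or_ne i j with rfl | hij
  · exact ⟨z i, hiI.1, hiI.1⟩
  have hRij := hR i (hJ' hi) j (hJ' hj) hij
  have hp : ∀ t, ∃ p : X t, (t ∈ Q i → p ∈ O i t) ∧ (t ∈ Q j → p ∈ O j t) := by
    intro t
    by_cases htR : t ∈ R
    · obtain ⟨p, hp⟩ := hK t htR i hi j hj
      exact ⟨p, fun _ => hp.1, fun _ => hp.2⟩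
    · by_cases hti : t ∈ Q i
      · refine ⟨z i t, fun _ => (hiI.2.1 t).2, fun htj => absurd ?_ htR⟩
        rw [← hRij]
        exact Finset.mem_inter.2 ⟨hti, htj⟩
      · exact ⟨z j t, fun hh => absurd hh hti, fun _ => (hjI.2.1 t).2⟩
  choose p hp using hp
  exact ⟨p, hiI.2.2 p fun t ht => (hp t).1 ht, hjI.2.2 p fun t ht => (hp t).2 ht⟩

end PropertyK

/-! ### Small families realizing all finite partial functions -/

section Independent

/-- The combinatorial core of the Hewitt–Marczewski–Pondiczery theorem: for `#T ≤ 2 ^ κ` and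
`#W ≤ κ` there are at most `κ` functions `T → W` realizing every finite partial function. -/
theorem exists_finitely_dense_family {T W : Type u} [Nonempty W] {κ : Cardinal.{u}} (hκ : ℵ₀ ≤ κ)
    (hT : #T ≤ 2 ^ κ) (hW : #W ≤ κ) :
    ∃ (Λ : Type u) (f : Λ → T → W), #Λ ≤ κ ∧
      ∀ (F : Finset T) (h : T → W), ∃ l, ∀ t ∈ F, f l t = h t := by
  classical
  have hK : #κ.out = κ := κ.mk_out
  have : Infinite κ.out := by rw [Cardinal.infinite_iff, hK]; exact hκ
  obtain ⟨r⟩ : Nonempty (T ↪ Set κ.out) := by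
    rw [← Cardinal.le_def, Cardinal.mk_set, hK]; exact hT
  have hfin : #(Finset κ.out) = κ := by rw [Cardinal.mk_finset_of_infinite, hK]
  have hprod : #(Finset κ.out × W) ≤ κ := by
    rw [Cardinal.mk_prod, Cardinal.lift_id, Cardinal.lift_id, hfin]
    exact Cardinal.mul_le_of_le hκ le_rfl hW
  -- An index is a finite `a ⊆ κ` with a finite table: `t`, coded by the subset `r t` of `κ`, is
  -- looked up by its trace on `a`.
  refine ⟨Finset κ.out × Finset (Finset κ.out × W), fun l t =>
    if h : ∃ w, (l.1.filter (· ∈ r t), w) ∈ l.2 then h.choose else Classical.arbitrary W, ?_, ?_⟩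
  · rw [Cardinal.mk_prod, Cardinal.lift_id, Cardinal.lift_id, hfin, Cardinal.mk_finset_of_infinite]
    exact Cardinal.mul_le_of_le hκ le_rfl hprod
  · intro F h
    have hsep : ∀ p : T × T, ∃ k, p.1 ≠ p.2 → ¬ (k ∈ r p.1 ↔ k ∈ r p.2) := by
      intro p
      by_cases hp : p.1 = p.2
      · exact ⟨Classical.arbitrary _, fun h => absurd hp h⟩
      · by_contra! hcon
        exact hp (r.injective (Set.ext fun k => (hcon k).2))
    choose k hk using hsep
    -- Enough points of `κ` to give distinct members of `F` distinct traces.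
    let a := (F ×ˢ F).image k
    refine ⟨(a, F.image fun t => (a.filter (· ∈ r t), h t)), fun t ht => ?_⟩
    have hex : ∃ w, (a.filter (· ∈ r t), w) ∈ F.image fun t => (a.filter (· ∈ r t), h t) :=
      ⟨h t, Finset.mem_image_of_mem _ ht⟩
    simp only [dif_pos hex]
    obtain ⟨t', ht', heq⟩ := Finset.mem_image.1 hex.choose_spec
    rw [Prod.mk.injEq] at heq
    rw [← heq.2]
    by_contra hne
    have htt : t' ≠ t := fun h' => hne (by rw [h'])
    have hmem : k (t', t) ∈ a := Finset.mem_image_of_mem _ (Finset.mk_mem_product ht' ht)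
    have := Finset.ext_iff.1 heq.1 (k (t', t))
    simp only [Finset.mem_filter, hmem, true_and] at this
    exact hk (t', t) htt this

end Independent

/-! ### The successor space and its property (K) -/

section SuccSpace

variable (Ω X : Type u) [LinearOrder Ω] [TopologicalSpace X]

/-- Arrays of nonempty clopen sets, indexed by pairs of elements of `Ω`. -/
abbrev ClopenArray : Type u := Ω → Ω → {a : Clopens X // (a : Set X).Nonempty}

variable {Ω X}

open Classical in
/-- Reset all rows of the array from `β` on. -/
noncomputable def ClopenArray.trunc [Nonempty X] (β : Ω) (s : ClopenArray Ω X) : ClopenArray Ω X :=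
  fun γ => if γ < β then s γ else fun _ => ⟨⊤, by simp⟩

theorem ClopenArray.eq_of_trunc_eq [Nonempty X] {β γ : Ω} {s t : ClopenArray Ω X}
    (h : s.trunc β = t.trunc β) (hγ : γ < β) : s γ = t γ := by
  have := congrFun h γ
  simpa only [ClopenArray.trunc, if_pos hγ] using this

/-- First differences are added to the supports of boxes. Then two arrays common to both boxes with
equal restrictions to `β` have equal rows at `β`, unless `β` lies in both supports. -/
theorem ClopenArray.exists_firstDiff [WellFoundedLT Ω] [Nonempty Ω] :
    ∃ δ : ClopenArray Ω X → ClopenArray Ω X → Ω, ∀ s t, s ≠ t →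
      s (δ s t) ≠ t (δ s t) ∧ ∀ γ < δ s t, s γ = t γ := by
  have : ∀ s t : ClopenArray Ω X, ∃ d : Ω, s ≠ t → s d ≠ t d ∧ ∀ γ < d, s γ = t γ := by
    intro s t
    by_cases h : s = t
    · exact ⟨Classical.arbitrary Ω, fun h' => absurd h h'⟩
    · have hne : {γ | s γ ≠ t γ}.Nonempty := Function.ne_iff.1 h
      refine ⟨wellFounded_lt.min _ hne, fun _ => ⟨wellFounded_lt.min_mem _ hne, fun γ hγ => ?_⟩⟩
      by_contra hcon
      exact wellFounded_lt.not_lt_min _ hcon hγ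
  choose δ hδ using this
  exact ⟨δ, hδ⟩

variable (Ω X) in
/-- The type of coordinates of the first factor of the space `succSet`. -/
abbrev SuccNode : Type u := Ω × Ω × ClopenArray Ω X

variable (Ω X) in
/-- The product in which `succSet` lives. -/
abbrev SuccAmbient : Type u := (SuccNode Ω X → X) × (Ω × ClopenArray Ω X → Bool)

variable [Nonempty X]

variable (Ω X) in
/-- The points `(v, y)` such that, whenever `y` holds at `(α, s)` and `(β, s)` with `α < β`, the
coordinate of `v` at `(α, β, s ↾ β)` lies in the clopen set `s β α`. -/
def succSet : Set (SuccAmbient Ω X) :=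
  {z | ∀ (s : ClopenArray Ω X) (α β : Ω), α < β → z.2 (α, s) = true → z.2 (β, s) = true →
    z.1 (α, β, s.trunc β) ∈ ((s β α).1 : Set X)}

theorem isClosed_succSet : IsClosed (succSet Ω X) := by
  simp only [succSet, ofPred_forall]
  refine isClosed_iInter fun s => isClosed_iInter fun α => isClosed_iInter fun β =>
    isClosed_iInter fun _ => ?_
  have hb : ∀ p : Ω × ClopenArray Ω X, IsOpen {z : SuccAmbient Ω X | z.2 p = true} := fun p => by
    have : Continuous fun z : SuccAmbient Ω X => z.2 p := by fun_prop
    exact (isOpen_discrete ({true} : Set Bool)).preimage this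
  have hX : IsClosed {z : SuccAmbient Ω X | z.1 (α, β, s.trunc β) ∈ ((s β α).1 : Set X)} :=
    (s β α).1.isClopen.1.preimage ((continuous_apply _).comp continuous_fst)
  have : {z : SuccAmbient Ω X | z.2 (α, s) = true → z.2 (β, s) = true →
      z.1 (α, β, s.trunc β) ∈ ((s β α).1 : Set X)} =
      {z | z.2 (α, s) = true}ᶜ ∪ ({z | z.2 (β, s) = true}ᶜ ∪
        {z | z.1 (α, β, s.trunc β) ∈ ((s β α).1 : Set X)}) := by
    ext z
    simp only [mem_ofPred_eq, mem_union, mem_compl_iff]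
    tauto
  rw [this]
  exact (hb _).isClosed_compl.union ((hb _).isClosed_compl.union hX)

/-- `(Q, O, P)` describes a basic neighbourhood of `z` which forces the constraints of `succSet`
for the pairs in `P` at which `z` holds. -/
structure IsSuccBox (z : SuccAmbient Ω X) (Q : Finset (SuccNode Ω X)) (O : SuccNode Ω X → Set X)
    (P : Finset (Ω × ClopenArray Ω X)) : Prop where
  isOpen : ∀ q, IsOpen (O q)
  mem : ∀ q, z.1 q ∈ O q
  forces : ∀ (s : ClopenArray Ω X) (α β : Ω), α < β → (α, s) ∈ P → (β, s) ∈ P →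
    z.2 (α, s) = true → z.2 (β, s) = true →
    (α, β, s.trunc β) ∈ Q ∧ O (α, β, s.trunc β) ⊆ (s β α).1

/-- The pairs from `P` impose finitely many clopen conditions, all satisfied by `z`, so the box can
be shrunk to force them. -/
theorem exists_isSuccBox {W : Set (SuccAmbient Ω X)} (hW : IsOpen W) {z : SuccAmbient Ω X}
    (hzW : z ∈ W) (hz : z ∈ succSet Ω X) :
    ∃ Q O P, IsSuccBox z Q O P ∧ ∀ z' : SuccAmbient Ω X, (∀ q ∈ Q, z'.1 q ∈ O q) →
      (∀ p ∈ P, z'.2 p = z.2 p) → z' ∈ W := by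
  classical
  obtain ⟨U, V, hU, hV, hzU, hzV, hUV⟩ := isOpen_prod_iff.1 hW z.1 z.2 hzW
  obtain ⟨Q, O, hO, hQ⟩ := hU.exists_box hzU
  obtain ⟨P, O', hO', hP⟩ := hV.exists_box hzV
  let C : (Ω × ClopenArray Ω X) × (Ω × ClopenArray Ω X) → SuccNode Ω X → Set X := fun p q =>
    {x | p.1.2 = p.2.2 → p.1.1 < p.2.1 → z.2 p.1 = true → z.2 p.2 = true →
      q = (p.1.1, p.2.1, p.1.2.trunc p.2.1) → x ∈ (p.1.2 p.2.1 p.1.1).1}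
  have hC : ∀ p q, IsOpen (C p q) := by
    intro p q
    by_cases h : p.1.2 = p.2.2 ∧ p.1.1 < p.2.1 ∧ z.2 p.1 = true ∧ z.2 p.2 = true ∧
        q = (p.1.1, p.2.1, p.1.2.trunc p.2.1)
    · have : C p q = ((p.1.2 p.2.1 p.1.1).1 : Set X) := by
        ext x
        simp only [C, mem_ofPred_eq, SetLike.mem_coe]
        tauto
      rw [this]
      exact (p.1.2 p.2.1 p.1.1).1.isClopen.2
    · have : C p q = Set.univ := by
        ext x
        simp only [C, mem_ofPred_eq, mem_univ, iff_true]
        tauto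
      rw [this]
      exact isOpen_univ
  refine ⟨Q ∪ (P ×ˢ P).image fun p => (p.1.1, p.2.1, p.1.2.trunc p.2.1),
    fun q => O q ∩ ⋂ p ∈ P ×ˢ P, C p q, P, ⟨?_, ?_, ?_⟩, ?_⟩
  · exact fun q => (hO q).1.inter (isOpen_biInter_finset fun p _ => hC p q)
  · refine fun q => ⟨(hO q).2, mem_iInter₂.2 fun p _ h1 h2 h3 h4 h5 => ?_⟩
    subst h5
    exact hz _ _ _ h2 h3 (by rw [h1]; exact h4)
  · intro s α β hαβ hα hβ h1 h2
    have hmem : ((α, s), (β, s)) ∈ P ×ˢ P := Finset.mk_mem_product hα hβ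
    refine ⟨Finset.mem_union_right _ (Finset.mem_image.2 ⟨_, hmem, rfl⟩), fun x hx => ?_⟩
    exact mem_iInter₂.1 hx.2 _ hmem rfl hαβ h1 h2 rfl
  · intro z' h1 h2
    refine hUV (mk_mem_prod (hQ _ fun q hq => ?_) (hP _ fun p hp => ?_))
    · exact (h1 q (Finset.mem_union_left _ hq)).1
    · rw [h2 p hp]
      exact (hO' p).2

/-- Amalgamation of two points of `succSet` over basic neighbourhoods with compatible supports. -/
theorem IsSuccBox.exists_common {z₁ z₂ : SuccAmbient Ω X} {Q₁ Q₂ : Finset (SuccNode Ω X)}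
    {O₁ O₂ : SuccNode Ω X → Set X} {P₁ P₂ : Finset (Ω × ClopenArray Ω X)}
    (h₁ : IsSuccBox z₁ Q₁ O₁ P₁) (h₂ : IsSuccBox z₂ Q₂ O₂ P₂)
    {v : SuccNode Ω X → X} (hv₁ : ∀ q ∈ Q₁, v q ∈ O₁ q) (hv₂ : ∀ q ∈ Q₂, v q ∈ O₂ q)
    {δ : ClopenArray Ω X → ClopenArray Ω X → Ω}
    (hδ : ∀ s t, s ≠ t → s (δ s t) ≠ t (δ s t) ∧ ∀ γ < δ s t, s γ = t γ)
    {S₁ S₂ : Finset Ω} {A₁ A₂ : Finset (ClopenArray Ω X)}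
    (hQ₁ : ∀ q ∈ Q₁, q.1 ∈ S₁ ∧ q.2.1 ∈ S₁) (hQ₂ : ∀ q ∈ Q₂, q.1 ∈ S₂ ∧ q.2.1 ∈ S₂)
    (hP₁ : ∀ p ∈ P₁, p.1 ∈ S₁ ∧ p.2 ∈ A₁) (hP₂ : ∀ p ∈ P₂, p.1 ∈ S₂ ∧ p.2 ∈ A₂)
    (hA₁ : ∀ s ∈ A₁, ∀ t ∈ A₁, δ s t ∈ S₁) (hA₂ : ∀ s ∈ A₂, ∀ t ∈ A₂, δ s t ∈ S₂)
    (h₁₂ : ∀ p ∈ P₁, z₁.2 p = true → p.1 ∈ S₂ → p.2 ∈ A₂ → p ∈ P₂ ∧ z₂.2 p = true)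
    (h₂₁ : ∀ p ∈ P₂, z₂.2 p = true → p.1 ∈ S₁ → p.2 ∈ A₁ → p ∈ P₁ ∧ z₁.2 p = true) :
    ∃ z ∈ succSet Ω X, ((∀ q ∈ Q₁, z.1 q ∈ O₁ q) ∧ ∀ p ∈ P₁, z.2 p = z₁.2 p) ∧
      ((∀ q ∈ Q₂, z.1 q ∈ O₂ q) ∧ ∀ p ∈ P₂, z.2 p = z₂.2 p) := by
  classical
  -- Nodes of the boxes keep the value of `v`. Any other node meets new constraints only from pairs
  -- with one index private to each side, and all of these ask for the same nonempty clopen set.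
  have hnode : ∀ q : SuccNode Ω X, ∃ x : X, (q ∈ Q₁ ∨ q ∈ Q₂ → x = v q) ∧
      ∀ s ∈ A₁, s ∈ A₂ → q.2.2 = s.trunc q.2.1 → (q.1 ∉ S₁ ∨ q.2.1 ∉ S₁) →
        (q.1 ∉ S₂ ∨ q.2.1 ∉ S₂) → (q.2.1 ∉ S₁ ∨ q.2.1 ∉ S₂) → x ∈ (s q.2.1 q.1).1 := by
    rintro ⟨α, β, r⟩
    by_cases hq : (α, β, r) ∈ Q₁ ∨ (α, β, r) ∈ Q₂
    · refine ⟨v (α, β, r), fun _ => rfl, fun s _ _ _ h1 h2 _ => ?_⟩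
      rcases hq with hq | hq
      · have := hQ₁ _ hq
        tauto
      · have := hQ₂ _ hq
        tauto
    · by_cases hs : ∃ s ∈ A₁, s ∈ A₂ ∧ r = s.trunc β
      · obtain ⟨s, hs1, hs2, rfl⟩ := hs
        obtain ⟨x, hx⟩ := (s β α).2
        refine ⟨x, fun h => absurd h hq, fun t ht1 ht2 hst _ _ hβ => ?_⟩
        have : s β = t β := by
          by_cases hne : s = t
          · rw [hne]
          obtain ⟨hd, hlt⟩ := hδ s t hne
          have hd1 := hA₁ s hs1 t ht1
          have hd2 := hA₂ s hs2 t ht2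
          rcases lt_trichotomy (δ s t) β with h | h | h
          · exact absurd (ClopenArray.eq_of_trunc_eq hst h) hd
          · simp only [h] at hd1 hd2
            tauto
          · exact hlt β h
        simp only [← this]
        exact hx
      · refine ⟨v (α, β, r), fun _ => rfl, fun s hs1 hs2 hr _ _ _ => absurd ?_ hs⟩
        exact ⟨s, hs1, hs2, hr⟩
  choose w hwv hws using hnode
  refine ⟨(w, fun p => decide ((p ∈ P₁ ∧ z₁.2 p = true) ∨ (p ∈ P₂ ∧ z₂.2 p = true))),
    ?_, ⟨fun q hq => ?_, fun p hp => ?_⟩, ⟨fun q hq => ?_, fun p hp => ?_⟩⟩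
  · intro s α β hαβ hα hβ
    simp only [decide_eq_true_eq] at hα hβ
    have hc1 : ((α, s) ∈ P₁ ∧ z₁.2 (α, s) = true) → ((β, s) ∈ P₁ ∧ z₁.2 (β, s) = true) →
        w (α, β, s.trunc β) ∈ (s β α).1 := by
      intro ha hb
      obtain ⟨hq, hO⟩ := h₁.forces s α β hαβ ha.1 hb.1 ha.2 hb.2
      rw [hwv _ (Or.inl hq)]
      exact hO (hv₁ _ hq)
    have hc2 : ((α, s) ∈ P₂ ∧ z₂.2 (α, s) = true) → ((β, s) ∈ P₂ ∧ z₂.2 (β, s) = true) →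
        w (α, β, s.trunc β) ∈ (s β α).1 := by
      intro ha hb
      obtain ⟨hq, hO⟩ := h₂.forces s α β hαβ ha.1 hb.1 ha.2 hb.2
      rw [hwv _ (Or.inr hq)]
      exact hO (hv₂ _ hq)
    have hkey := hws (α, β, s.trunc β) s
    rcases hα with ha | ha <;> rcases hβ with hb | hb
    · exact hc1 ha hb
    -- A mixed pair: if either index lies in the other side's support, the agreement hypotheses put
    -- the whole pair in one box; otherwise `hws` applies.
    · have ha' := hP₁ _ ha.1
      have hb' := hP₂ _ hb.1
      by_cases h : α ∈ S₂
      · exact hc2 (h₁₂ _ ha.1 ha.2 h hb'.2) hb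
      by_cases h' : β ∈ S₁
      · exact hc1 ha (h₂₁ _ hb.1 hb.2 h' ha'.2)
      exact hkey ha'.2 hb'.2 rfl (Or.inr h') (Or.inl h) (Or.inl h')
    · have ha' := hP₂ _ ha.1
      have hb' := hP₁ _ hb.1
      by_cases h : α ∈ S₁
      · exact hc1 (h₂₁ _ ha.1 ha.2 h hb'.2) hb
      by_cases h' : β ∈ S₂
      · exact hc2 ha (h₁₂ _ hb.1 hb.2 h' ha'.2)
      exact hkey hb'.2 ha'.2 rfl (Or.inl h) (Or.inr h') (Or.inr h')
    · exact hc2 ha hb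
  · simp only [hwv q (Or.inl hq)]
    exact hv₁ q hq
  · rw [Bool.eq_iff_iff, decide_eq_true_eq]
    refine ⟨?_, fun h => Or.inl ⟨hp, h⟩⟩
    rintro (h | h)
    · exact h.2
    · exact (h₂₁ p h.1 h.2 (hP₁ p hp).1 (hP₁ p hp).2).2
  · simp only [hwv q (Or.inr hq)]
    exact hv₂ q hq
  · rw [Bool.eq_iff_iff, decide_eq_true_eq]
    refine ⟨?_, fun h => Or.inr ⟨hp, h⟩⟩
    rintro (h | h)
    · exact (h₁₂ p h.1 h.2 (hP₂ p hp).1 (hP₂ p hp).2).2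
    · exact h.2

/-- Thin out so that the `X`-boxes meet pairwise, the index supports and the array supports form
Δ-systems, and the true coordinates over the two roots agree; then amalgamate. -/
theorem propertyK_succSet [WellFoundedLT Ω] [Nonempty Ω] (hX : PropertyK X) :
    PropertyK (succSet Ω X) := by
  classical
  intro ι W I hI hW
  obtain ⟨δ, hδ⟩ := ClopenArray.exists_firstDiff (Ω := Ω) (X := X)
  have hbox : ∀ i, ∃ (z : SuccAmbient Ω X) (Q : Finset (SuccNode Ω X)) (O : SuccNode Ω X → Set X)
      (P : Finset (Ω × ClopenArray Ω X)), i ∈ I → (IsSuccBox z Q O P ∧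
        ∃ hz : z ∈ succSet Ω X, ⟨z, hz⟩ ∈ W i ∧
          ∀ z' : succSet Ω X, (∀ q ∈ Q, z'.1.1 q ∈ O q) → (∀ p ∈ P, z'.1.2 p = z.2 p) →
            z' ∈ W i) := by
    intro i
    by_cases hi : i ∈ I
    · obtain ⟨ho, ⟨z, hz⟩, hzW⟩ := hW i hi
      obtain ⟨V, hV, hVW⟩ := isOpen_induced_iff.1 ho
      have hzV : z ∈ V := by
        rw [← hVW] at hzW
        exact hzW
      obtain ⟨Q, O, P, h, h'⟩ := exists_isSuccBox hV hzV hz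
      refine ⟨z, Q, O, P, fun _ => ⟨h, hz, hzW, fun z' h1 h2 => ?_⟩⟩
      rw [← hVW]
      exact h' _ h1 h2
    · exact ⟨(fun _ => Classical.arbitrary X, fun _ => false), ∅, fun _ => ∅, ∅,
        fun h => absurd h hi⟩
  choose z Q O P h using hbox
  obtain ⟨J₁, hJ₁, hJ₁c, hK⟩ := PropertyK.pi (fun _ : SuccNode Ω X => hX)
    (fun i => {v | ∀ q ∈ Q i, v q ∈ O i q}) I hI (by
      intro i hi
      refine ⟨?_, (z i).1, fun q _ => (h i hi).1.mem q⟩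
      simpa only [Set.pi, Finset.mem_coe] using
        isOpen_set_pi (Q i).finite_toSet fun q _ => (h i hi).1.isOpen q)
  let A : ι → Finset (ClopenArray Ω X) := fun i => (P i).image Prod.snd
  let S : ι → Finset Ω := fun i => (P i).image Prod.fst ∪ (Q i).image (fun q => q.1) ∪
    (Q i).image (fun q => q.2.1) ∪ (A i ×ˢ A i).image fun p => δ p.1 p.2
  obtain ⟨J₂, hJ₂, hJ₂c, R, hR⟩ := exists_deltaSystem S J₁ hJ₁c
  obtain ⟨J₃, hJ₃, hJ₃c, R', hR'⟩ := exists_deltaSystem A J₂ hJ₂c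
  obtain ⟨C, hC⟩ := exists_uncountable_fiber (β := (R ×ˢ R').powerset) (fun i =>
    ⟨(R ×ˢ R').filter fun p => p ∈ P i ∧ (z i).2 p = true, by simp⟩) hJ₃c
  have hsub : {i ∈ J₃ | (⟨(R ×ˢ R').filter fun p => p ∈ P i ∧ (z i).2 p = true, by simp⟩ :
      (R ×ˢ R').powerset) = C} ⊆ I := fun i hi => hJ₁ (hJ₂ (hJ₃ hi.1))
  refine ⟨_, hsub, hC, fun i hi j hj => ?_⟩
  have hiI := h i (hsub hi)
  have hjI := h j (hsub hj)
  rcases eq_or_ne i j with rfl | hij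
  · exact ⟨_, hiI.2.choose_spec.1, hiI.2.choose_spec.1⟩
  have hRij := hR i (hJ₃ hi.1) j (hJ₃ hj.1) hij
  have hRij' := hR' i hi.1 j hj.1 hij
  obtain ⟨v, hvi, hvj⟩ := hK i (hJ₂ (hJ₃ hi.1)) j (hJ₂ (hJ₃ hj.1))
  have hCij : ∀ p, p.1 ∈ S i → p.1 ∈ S j → p.2 ∈ A i → p.2 ∈ A j →
      ((p ∈ P i ∧ (z i).2 p = true) ↔ (p ∈ P j ∧ (z j).2 p = true)) := by
    intro p h1 h2 h3 h4
    have hp : p ∈ R ×ˢ R' := by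
      rw [Finset.mem_product, ← hRij, ← hRij', Finset.mem_inter, Finset.mem_inter]
      exact ⟨⟨h1, h2⟩, h3, h4⟩
    have := Finset.ext_iff.1 (Subtype.ext_iff.1 (hi.2.trans hj.2.symm)) p
    simpa only [Finset.mem_filter, hp, true_and] using this
  have hQS : ∀ i, ∀ q ∈ Q i, q.1 ∈ S i ∧ q.2.1 ∈ S i := by
    intro i q hq
    simp only [S, Finset.mem_union]
    exact ⟨Or.inl (Or.inl (Or.inr (Finset.mem_image_of_mem _ hq))),
      Or.inl (Or.inr (Finset.mem_image.2 ⟨q, hq, rfl⟩))⟩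
  have hPS : ∀ i, ∀ p ∈ P i, p.1 ∈ S i ∧ p.2 ∈ A i := by
    intro i p hp
    simp only [S, Finset.mem_union]
    exact ⟨Or.inl (Or.inl (Or.inl (Finset.mem_image_of_mem _ hp))), Finset.mem_image_of_mem _ hp⟩
  have hAS : ∀ i, ∀ s ∈ A i, ∀ t ∈ A i, δ s t ∈ S i := by
    intro i s hs t ht
    simp only [S, Finset.mem_union]
    exact Or.inr (Finset.mem_image.2 ⟨(s, t), Finset.mk_mem_product hs ht, rfl⟩)
  obtain ⟨x, hx, hx1, hx2⟩ := hiI.1.exists_common hjI.1 hvi hvj hδ (hQS i) (hQS j) (hPS i) (hPS j)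
    (hAS i) (hAS j)
    (fun p hp hz h1 h2 => (hCij p (hPS i p hp).1 h1 (hPS i p hp).2 h2).1 ⟨hp, hz⟩)
    (fun p hp hz h1 h2 => (hCij p h1 (hPS j p hp).1 h2 (hPS j p hp).2).2 ⟨hp, hz⟩)
  exact ⟨⟨x, hx⟩, hiI.2.choose_spec.2 ⟨x, hx⟩ hx1.1 hx1.2,
    hjI.2.choose_spec.2 ⟨x, hx⟩ hx2.1 hx2.2⟩

end SuccSpace

/-! ### Dense sets and clopen sets -/

section Density

/-- A clopen set is determined by its trace on a dense set. -/
theorem mk_clopens_le {X : Type u} [TopologicalSpace X] {D : Set X} (hD : Dense D) :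
    #(Clopens X) ≤ 2 ^ #D := by
  rw [← Cardinal.mk_set]
  refine Cardinal.mk_le_of_injective (f := fun a : Clopens X => (Subtype.val ⁻¹' (a : Set X) : Set D))
    fun a b hab => ?_
  have key : ∀ a b : Clopens X, (Subtype.val ⁻¹' (a : Set X) : Set D) = Subtype.val ⁻¹' (b : Set X) →
      (a : Set X) ⊆ b := by
    intro a b hab
    by_contra hcon
    obtain ⟨x, hxa, hxb⟩ := not_subset.1 hcon
    obtain ⟨y, hy, hyD⟩ := hD.inter_open_nonempty _ (a.isClopen.2.inter b.isClopen.1.isOpen_compl)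
      ⟨x, hxa, hxb⟩
    have : (⟨y, hyD⟩ : D) ∈ (Subtype.val ⁻¹' (a : Set X) : Set D) := hy.1
    rw [hab] at this
    exact hy.2 this
  exact SetLike.coe_injective ((key a b hab).antisymm (key b a hab.symm))

theorem exists_clopen_avoiding {X : Type u} [TopologicalSpace X] [CompactSpace X] [T2Space X]
    [TotallyDisconnectedSpace X] {D : Set X} (hD : ¬ Dense D) :
    ∃ a : {a : Clopens X // (a : Set X).Nonempty}, ∀ x ∈ D, x ∉ a.1 := by
  obtain ⟨x, hx⟩ : ∃ x, x ∉ closure D := by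
    by_contra! h
    exact hD h
  obtain ⟨a, ha, hxa, hsub⟩ := isTopologicalBasis_isClopen.exists_subset_of_mem_open
    (show x ∈ (closure D)ᶜ from hx) isClosed_closure.isOpen_compl
  exact ⟨⟨⟨a, ha⟩, x, hxa⟩, fun y hy hya => hsub hya (subset_closure hy)⟩

end Density

theorem mk_Iic_toType_lt {κ : Cardinal.{u}} (hκ : ℵ₀ ≤ κ) (k : κ.ord.ToType) : #(Iic k) < κ := by
  have h : #(Iio k) < #κ.ord.ToType := Cardinal.mk_Iio_lt k (by simp)
  rw [Cardinal.mk_ord_toType] at h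
  rw [← Iio_insert]
  exact Cardinal.mk_insert_le.trans_lt
    (Cardinal.add_lt_of_lt hκ h (Cardinal.one_lt_aleph0.trans_le hκ))

/-! ### The density of the successor space -/

section SuccDensity

variable {Ω X : Type u} [LinearOrder Ω] [TopologicalSpace X] [Nonempty X] {κ : Cardinal.{u}}

theorem exists_diagonal_array [WellFoundedLT Ω] {K I : Type u} [LinearOrder K]
    (u : I → SuccNode Ω X → X) (rank : I → K) (e : Ω → Ω → K)
    (hpick : ∀ (k : K) (q : SuccNode Ω X), ∃ a : {a : Clopens X // (a : Set X).Nonempty},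
      ∀ i, rank i < k → u i q ∉ a.1) :
    ∃ s : ClopenArray Ω X, ∀ α β i, rank i < e β α → u i (α, β, s.trunc β) ∉ (s β α).1 := by
  classical
  choose pick hpick using hpick
  -- Row `β` needs only `s ↾ β`; padding with `⊤` from `β` on matches `ClopenArray.trunc`.
  let step : ∀ β : Ω, (∀ γ, γ < β → Ω → {a : Clopens X // (a : Set X).Nonempty}) →
      Ω → {a : Clopens X // (a : Set X).Nonempty} := fun β prev α =>
    pick (e β α) (α, β, fun γ => if h : γ < β then prev γ h else fun _ => ⟨⊤, by simp⟩)
  let s : ClopenArray Ω X := (wellFounded_lt (α := Ω)).fix step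
  have hs : ∀ α β, s β α = pick (e β α) (α, β, s.trunc β) := by
    intro α β
    have : s β = step β fun γ _ => s γ := WellFounded.fix_eq _ _ _
    rw [this]
    simp only [step, dite_eq_ite]
    rfl
  refine ⟨s, fun α β i hi => ?_⟩
  rw [hs]
  exact hpick _ _ i hi

theorem succ_le_mk_of_dense_succSet [WellFoundedLT Ω] [CompactSpace X] [T2Space X]
    [TotallyDisconnectedSpace X] (hκ : ℵ₀ ≤ κ) (hΩ : #Ω = Order.succ κ)
    (hΩβ : ∀ β : Ω, #(Iic β) ≤ κ) (hX : ∀ D : Set X, Dense D → κ ≤ #D)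
    (D : Set (succSet Ω X)) (hD : Dense D) : Order.succ κ ≤ #D := by
  classical
  by_contra! hlt
  rw [Order.lt_succ_iff] at hlt
  have hK : #κ.ord.ToType = κ := Cardinal.mk_ord_toType κ
  obtain ⟨rank⟩ : Nonempty (D ↪ κ.ord.ToType) := by rwa [← Cardinal.le_def, hK]
  have he : ∀ β : Ω, Nonempty (Iic β ↪ κ.ord.ToType) := fun β => by
    rw [← Cardinal.le_def, hK]
    exact hΩβ β
  have hKne : Nonempty κ.ord.ToType := by
    rw [← Cardinal.mk_ne_zero_iff, hK]
    exact (Cardinal.aleph0_pos.trans_le hκ).ne'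
  let e : Ω → Ω → κ.ord.ToType := fun β α =>
    if h : α ≤ β then (he β).some ⟨α, h⟩ else Classical.arbitrary _
  have heinj : ∀ β, InjOn (e β) (Iic β) := by
    intro β α hα α' hα' h
    have h1 : α ≤ β := hα
    have h2 : α' ≤ β := hα'
    simp only [e, dif_pos h1, dif_pos h2] at h
    exact Subtype.ext_iff.1 ((he β).some.injective h)
  obtain ⟨s, hs⟩ := exists_diagonal_array (fun i : D => i.1.1.1) rank e (by
    intro k q
    obtain ⟨a, ha⟩ := exists_clopen_avoiding
      (D := (fun i : D => i.1.1.1 q) '' (rank ⁻¹' Iio k)) (fun hd => by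
        refine (hX _ hd).not_gt (Cardinal.mk_image_le.trans_lt
          (lt_of_le_of_lt ?_ (mk_Iic_toType_lt hκ k)))
        exact (Cardinal.mk_preimage_of_injective _ _ rank.injective).trans
          (Cardinal.mk_le_mk_of_subset Iio_subset_Iic_self))
    exact ⟨a, fun i hi => ha _ ⟨i, hi, rfl⟩⟩)
  -- The open condition is nonempty: a point whose only true coordinate is `(α, s)` meets every
  -- constraint vacuously.
  have hg : ∀ α, ∃ i : D, i.1.1.2 (α, s) = true := by
    intro α
    have hc : Continuous fun z : succSet Ω X => z.1.2 (α, s) := by fun_prop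
    obtain ⟨y, hy, hyD⟩ := hD.inter_open_nonempty _
      ((isOpen_discrete ({true} : Set Bool)).preimage hc)
      ⟨⟨(fun _ => Classical.arbitrary X, fun p => decide (p = (α, s))), by
        intro t α' β' hlt h1 h2
        simp only [decide_eq_true_eq, Prod.mk.injEq] at h1 h2
        exact absurd (h1.1.trans h2.1.symm) hlt.ne⟩, by simp⟩
    exact ⟨⟨y, hyD⟩, hy⟩
  choose g hg using hg
  obtain ⟨i, hi⟩ := Cardinal.infinite_pigeonhole_card g (Order.succ κ) hΩ.ge
    (hκ.trans (Order.le_succ κ)) (by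
      rw [(Cardinal.isRegular_succ hκ).cof_ord]
      exact Order.lt_succ_of_le hlt)
  obtain ⟨Z, hZ, hZκ⟩ := Cardinal.le_mk_iff_exists_subset.1 ((Order.le_succ κ).trans hi)
  have hU : #(⋃ x ∈ Z, Iic x : Set Ω) ≤ κ := by
    refine (Cardinal.mk_biUnion_le _ _).trans ?_
    rw [hZκ]
    exact Cardinal.mul_le_of_le hκ le_rfl (ciSup_le' fun x => hΩβ x)
  obtain ⟨β, hβ, hβU⟩ : ∃ β ∈ g ⁻¹' {i}, β ∉ (⋃ x ∈ Z, Iic x : Set Ω) := by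
    by_contra! hcon
    have := (hi.trans (Cardinal.mk_le_mk_of_subset hcon)).trans hU
    exact (Order.lt_succ κ).not_ge this
  have hZβ : ∀ α ∈ Z, α < β := by
    intro α hα
    by_contra! hcon
    exact hβU (mem_iUnion₂.2 ⟨α, hα, hcon⟩)
  -- For `α ∈ Z` the point `i` selects both `α` and `β`, so its value lies in `s β α`; by the choice
  -- of `s` this excludes `rank i < e β α`.
  have hle : e β '' Z ⊆ Iic (rank i) := by
    rintro _ ⟨α, hα, rfl⟩
    by_contra hcon
    have hgα : g α = i := hZ hα
    have hgβ : g β = i := hβ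
    refine hs α β i (not_le.1 hcon) (i.1.2 s α β (hZβ α hα) ?_ ?_)
    · rw [← hgα]; exact hg α
    · rw [← hgβ]; exact hg β
  have hcard : #(e β '' Z) = κ := by
    rw [Cardinal.mk_image_eq_of_injOn _ _ ((heinj β).mono fun α hα => (hZβ α hα).le), hZκ]
  exact (mk_Iic_toType_lt hκ (rank i)).not_ge
    (hcard.ge.trans (Cardinal.mk_le_mk_of_subset hle))

/-- There are at most `2 ^ κ⁺` coordinates, so `κ⁺` many pairs of functions realize all finite
patterns: values in `D` at nodes and finite selected sets at arrays. -/
theorem exists_dense_succSet (hκ : ℵ₀ ≤ κ) (hΩ : #Ω = Order.succ κ) {D : Set X} (hD : Dense D)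
    (hDκ : #D ≤ κ) : ∃ E : Set (succSet Ω X), #E ≤ Order.succ κ ∧ Dense E := by
  classical
  have hκ' : ℵ₀ ≤ Order.succ κ := hκ.trans (Order.le_succ κ)
  have hA : #{a : Clopens X // (a : Set X).Nonempty} ≤ 2 ^ Order.succ κ :=
    (Cardinal.mk_subtype_le _).trans ((mk_clopens_le hD).trans
      (Cardinal.power_le_power_left two_ne_zero (hDκ.trans (Order.le_succ κ))))
  have hpow : ∀ c : Cardinal.{u}, c ≤ 2 ^ Order.succ κ → c ^ Order.succ κ ≤ 2 ^ Order.succ κ := by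
    intro c hc
    refine (Cardinal.power_le_power_right hc).trans ?_
    rw [← Cardinal.power_mul, Cardinal.mul_eq_self hκ']
  have hS : #(ClopenArray Ω X) ≤ 2 ^ Order.succ κ := by
    simp only [ClopenArray, Cardinal.mk_pi, Cardinal.prod_const, Cardinal.lift_id, hΩ]
    exact hpow _ (hpow _ hA)
  have hinf : ℵ₀ ≤ (2 : Cardinal.{u}) ^ Order.succ κ := hκ'.trans (Cardinal.cantor _).le
  have hΩ2 : #Ω ≤ 2 ^ Order.succ κ := hΩ.le.trans (Cardinal.cantor _).le
  have hT : #(SuccNode Ω X) ≤ 2 ^ Order.succ κ := by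
    simp only [SuccNode, Cardinal.mk_prod, Cardinal.lift_id]
    exact Cardinal.mul_le_of_le hinf hΩ2 (Cardinal.mul_le_of_le hinf hΩ2 hS)
  have hΩinf : Infinite Ω := by rw [Cardinal.infinite_iff, hΩ]; exact hκ'
  have hDne : Nonempty D := hD.nonempty.to_subtype
  obtain ⟨Λ₁, f₁, hΛ₁, hf₁⟩ := exists_finitely_dense_family (W := D) hκ' hT
    (hDκ.trans (Order.le_succ κ))
  obtain ⟨Λ₂, f₂, hΛ₂, hf₂⟩ := exists_finitely_dense_family (W := Finset Ω) hκ' hS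
    (by rw [Cardinal.mk_finset_of_infinite, hΩ])
  -- If any constraint from the finite set proposed for an array fails, the whole selection for that
  -- array becomes empty, which keeps the point in `succSet`. Inside a box the constraints are
  -- forced, so nothing needed is lost.
  let z : Λ₁ × Λ₂ → succSet Ω X := fun l =>
    ⟨(fun q => f₁ l.1 q, fun p => decide (p.1 ∈ f₂ l.2 p.2 ∧ ∀ α ∈ f₂ l.2 p.2, ∀ β ∈ f₂ l.2 p.2,
      α < β → (f₁ l.1 (α, β, p.2.trunc β) : X) ∈ (p.2 β α).1)), by
      intro s α β hlt hα hβ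
      simp only [decide_eq_true_eq] at hα hβ
      exact hα.2 α hα.1 β hβ.1 hlt⟩
  refine ⟨range z, ?_, ?_⟩
  · refine Cardinal.mk_range_le.trans ?_
    rw [Cardinal.mk_prod, Cardinal.lift_id, Cardinal.lift_id]
    exact Cardinal.mul_le_of_le hκ' hΛ₁ hΛ₂
  · refine dense_iff_inter_open.2 fun W hW ⟨⟨x, hx⟩, hxW⟩ => ?_
    obtain ⟨V, hV, rfl⟩ := isOpen_induced_iff.1 hW
    obtain ⟨Q, O, P, hbox, h⟩ := exists_isSuccBox hV hxW hx
    have hd : ∀ q, ∃ d : D, (d : X) ∈ O q := by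
      intro q
      obtain ⟨y, hy, hyD⟩ := hD.inter_open_nonempty _ (hbox.isOpen q) ⟨_, hbox.mem q⟩
      exact ⟨⟨y, hyD⟩, hy⟩
    choose d hd using hd
    obtain ⟨l₁, hl₁⟩ := hf₁ Q d
    obtain ⟨l₂, hl₂⟩ := hf₂ (P.image Prod.snd) fun s =>
      (P.filter fun p => p.2 = s ∧ x.2 p = true).image Prod.fst
    have hmem : ∀ p ∈ P, ∀ α, α ∈ f₂ l₂ p.2 ↔ (α, p.2) ∈ P ∧ x.2 (α, p.2) = true := by
      intro p hp α
      rw [hl₂ _ (Finset.mem_image_of_mem _ hp)]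
      simp only [Finset.mem_image, Finset.mem_filter]
      constructor
      · rintro ⟨⟨a, s⟩, ⟨h1, h2, h3⟩, h4⟩
        simp only at h2 h4
        subst h2 h4
        exact ⟨h1, h3⟩
      · rintro ⟨h1, h2⟩
        exact ⟨(α, p.2), ⟨h1, rfl, h2⟩, rfl⟩
    refine ⟨z (l₁, l₂), h _ (fun q hq => ?_) (fun p hp => ?_), mem_range_self _⟩
    · simp only [z, hl₁ q hq]
      exact hd q
    · simp only [z]
      rw [Bool.eq_iff_iff, decide_eq_true_eq, hmem p hp]
      refine ⟨fun h => h.1.2, fun hxp => ⟨⟨hp, hxp⟩, fun α hα β hβ hlt => ?_⟩⟩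
      rw [hmem p hp] at hα hβ
      obtain ⟨hq, hO⟩ := hbox.forces p.2 α β hlt hα.1 hβ.1 hα.2 hβ.2
      rw [hl₁ _ hq]
      exact hO (hd _)

end SuccDensity

/-! ### Induction on the density -/

section Induction

/-- There is a nonempty Stone space with property (K) whose density is exactly `κ`. -/
def HasStoneSpaceOfDensity (κ : Cardinal.{u}) : Prop :=
  ∃ (X : Type u) (_ : TopologicalSpace X), CompactSpace X ∧ T2Space X ∧
    TotallyDisconnectedSpace X ∧ Nonempty X ∧ PropertyK X ∧
    (∃ D : Set X, #D ≤ κ ∧ Dense D) ∧ ∀ D : Set X, Dense D → κ ≤ #D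

theorem propertyK_of_secondCountable (X : Type u) [TopologicalSpace X]
    [SecondCountableTopology X] : PropertyK X := by
  intro ι W I hI hW
  have hB := isBasis_countableBasis X
  have : Countable (countableBasis X) := (countable_countableBasis X).to_subtype
  have hsub : ∀ i : I, ∃ b : countableBasis X, b.1.Nonempty ∧ b.1 ⊆ W i := by
    rintro ⟨i, hi⟩
    obtain ⟨ho, x, hx⟩ := hW i hi
    obtain ⟨b, hb, hxb, hbW⟩ := hB.exists_subset_of_mem_open hx ho
    exact ⟨⟨b, hb⟩, ⟨x, hxb⟩, hbW⟩
  choose b hb hbW using hsub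
  obtain ⟨c, hc⟩ := exists_uncountable_fiber (I := (Set.univ : Set I)) b (by
    rwa [countable_univ_iff])
  refine ⟨Subtype.val '' {i ∈ (Set.univ : Set I) | b i = c}, by rintro _ ⟨i, _, rfl⟩; exact i.2,
    fun h => hc (countable_of_injective_of_countable_image Subtype.val_injective.injOn h), ?_⟩
  rintro _ ⟨i, hi, rfl⟩ _ ⟨j, hj, rfl⟩
  obtain ⟨x, hx⟩ := hb i
  exact ⟨x, hbW i hx, hbW j (by rw [hj.2, ← hi.2]; exact hx)⟩

theorem hasStoneSpaceOfDensity_aleph0 : HasStoneSpaceOfDensity.{u} ℵ₀ := by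
  refine ⟨ULift.{u} ℕ → Bool, inferInstance, inferInstance, inferInstance, inferInstance,
    inferInstance, propertyK_of_secondCountable _, ?_, fun D hD => ?_⟩
  · obtain ⟨D, hDc, hD⟩ := exists_countable_dense (ULift.{u} ℕ → Bool)
    exact ⟨D, Cardinal.le_aleph0_iff_set_countable.2 hDc, hD⟩
  · by_contra! h
    have hfin : D.Finite := Cardinal.lt_aleph0_iff_set_finite.1 h
    have := hD.closure_eq
    rw [hfin.isClosed.closure_eq] at this
    exact infinite_univ (this ▸ hfin)

theorem HasStoneSpaceOfDensity.succ {κ : Cardinal.{u}} (hκ : ℵ₀ ≤ κ)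
    (h : HasStoneSpaceOfDensity κ) : HasStoneSpaceOfDensity (Order.succ κ) := by
  obtain ⟨X, _, _, _, _, _, hK, ⟨D, hDκ, hD⟩, hX⟩ := h
  have hΩ : #(Order.succ κ).ord.ToType = Order.succ κ := Cardinal.mk_ord_toType _
  have hκ' : ℵ₀ ≤ Order.succ κ := hκ.trans (Order.le_succ κ)
  have hne : Nonempty (Order.succ κ).ord.ToType := by
    rw [← Cardinal.mk_ne_zero_iff, hΩ]
    exact (Cardinal.aleph0_pos.trans_le hκ').ne'
  refine ⟨succSet (Order.succ κ).ord.ToType X, inferInstance,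
    isCompact_iff_compactSpace.1 isClosed_succSet.isCompact, inferInstance, inferInstance,
    ⟨⟨(fun _ => Classical.arbitrary X, fun _ => false), fun _ _ _ _ h => by simp at h⟩⟩,
    propertyK_succSet hK, exists_dense_succSet hκ hΩ hD hDκ,
    succ_le_mk_of_dense_succSet hκ hΩ (fun β => ?_) hX⟩
  exact Order.lt_succ_iff.1 (mk_Iic_toType_lt hκ' β)

theorem exists_dense_pi {T : Type u} {X : T → Type u} [∀ t, TopologicalSpace (X t)]
    [∀ t, Nonempty (X t)] {κ : Cardinal.{u}} (hκ : ℵ₀ ≤ κ) (hT : #T ≤ 2 ^ κ)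
    (D : ∀ t, Set (X t)) (hDκ : ∀ t, #(D t) ≤ κ) (hD : ∀ t, Dense (D t)) :
    ∃ E : Set (∀ t, X t), #E ≤ κ ∧ Dense E := by
  have hW : Nonempty κ.out := by
    rw [← Cardinal.mk_ne_zero_iff, Cardinal.mk_out]
    exact (Cardinal.aleph0_pos.trans_le hκ).ne'
  have hg : ∀ t, ∃ g : κ.out → D t, Function.Surjective g := by
    intro t
    have : Nonempty (D t) := (hD t).nonempty.to_subtype
    obtain ⟨i⟩ : Nonempty (D t ↪ κ.out) := by
      rw [← Cardinal.le_def, Cardinal.mk_out]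
      exact hDκ t
    exact ⟨Function.invFun i, Function.invFun_surjective i.injective⟩
  choose g hg using hg
  obtain ⟨Λ, f, hΛ, hf⟩ := exists_finitely_dense_family (W := κ.out) hκ hT (Cardinal.mk_out κ).le
  refine ⟨range fun l t => (g t (f l t) : X t), Cardinal.mk_range_le.trans hΛ, ?_⟩
  refine dense_iff_inter_open.2 fun W hW ⟨z, hz⟩ => ?_
  obtain ⟨Q, O, hO, hQ⟩ := hW.exists_box hz
  have hd : ∀ t, ∃ w : κ.out, (g t w : X t) ∈ O t := by
    intro t
    obtain ⟨y, hy, hyD⟩ := (hD t).inter_open_nonempty _ (hO t).1 ⟨_, (hO t).2⟩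
    obtain ⟨w, hw⟩ := hg t ⟨y, hyD⟩
    exact ⟨w, by rw [hw]; exact hy⟩
  choose w hw using hd
  obtain ⟨l, hl⟩ := hf Q w
  refine ⟨_, hQ _ fun t ht => ?_, mem_range_self l⟩
  rw [hl t ht]
  exact hw t

theorem exists_mk_Iio_toType_eq {c κ : Cardinal.{u}} (h : c < κ) :
    ∃ t : κ.ord.ToType, #(Iio t) = c := by
  obtain ⟨t, ht⟩ := Ordinal.typein_surj (α := κ.ord.ToType) LT.lt (o := c.ord)
    (by simpa using Cardinal.ord_lt_ord.2 h)
  refine ⟨t, ?_⟩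
  have h2 := Ordinal.card_typein (r := LT.lt) t
  rw [ht, Cardinal.card_ord] at h2
  exact h2.symm

theorem hasStoneSpaceOfDensity_of_limit {κ : Cardinal.{u}} (hκ : ℵ₀ < κ)
    (hlim : ∀ c < κ, Order.succ c < κ)
    (ih : ∀ c < κ, ℵ₀ ≤ c → HasStoneSpaceOfDensity c) : HasStoneSpaceOfDensity κ := by
  have hT : #κ.ord.ToType = κ := Cardinal.mk_ord_toType κ
  -- The maximum with `ℵ₀` lets `ih` apply at finite initial segments too.
  have hlt : ∀ t : κ.ord.ToType, max ℵ₀ #(Iic t) < κ := fun t =>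
    max_lt hκ (mk_Iic_toType_lt hκ.le t)
  have hmodel := fun t => ih _ (hlt t) (le_max_left _ _)
  choose X hXtop hXc hXt2 hXtd hXne hXK hXD hXlow using hmodel
  choose D hDle hD using hXD
  refine ⟨∀ t, X t, inferInstance, inferInstance, inferInstance, inferInstance, inferInstance,
    fun ι W I => PropertyK.pi hXK W I,
    exists_dense_pi hκ.le (hT.le.trans (Cardinal.cantor κ).le) D
      (fun t => (hDle t).trans (hlt t).le) hD, fun E hE => ?_⟩
  by_contra! hEκ
  -- The factor at this `t` has density above `#E`, yet the projection of `E` is dense in it.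
  obtain ⟨t, ht⟩ := exists_mk_Iio_toType_eq (hlim _ hEκ)
  replace ht : Order.succ #E ≤ #(Iic t) :=
    ht.ge.trans (Cardinal.mk_le_mk_of_subset Iio_subset_Iic_self)
  have hproj : Dense ((fun z : ∀ t, X t => z t) '' E) :=
    (Function.surjective_eval t).denseRange.dense_image (continuous_apply t) hE
  have := (hXlow t _ hproj).trans Cardinal.mk_image_le
  exact (Order.lt_succ #E).not_ge ((ht.trans (le_max_right _ _)).trans this)

theorem hasStoneSpaceOfDensity (κ : Cardinal.{u}) (hκ : ℵ₀ ≤ κ) : HasStoneSpaceOfDensity κ := by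
  induction κ using WellFoundedLT.induction with
  | ind κ ih =>
    rcases hκ.eq_or_lt with rfl | hlt
    · exact hasStoneSpaceOfDensity_aleph0
    by_cases h : ∃ c < κ, κ ≤ Order.succ c
    · obtain ⟨c, hc, hκc⟩ := h
      obtain rfl : κ = Order.succ c := hκc.antisymm (Order.succ_le_of_lt hc)
      have hc0 := Order.lt_succ_iff.1 hlt
      exact (ih c hc hc0).succ hc0
    · push Not at h
      exact hasStoneSpaceOfDensity_of_limit hlt h ih

end Induction

/-! ### From Stone spaces back to clopen algebras -/

section Clopens

variable {X : Type u} [TopologicalSpace X]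

theorem PropertyK.countableChainCondition (hX : PropertyK X) :
    BACountableChainCondition (Clopens X) := by
  intro A hA hdis
  by_contra hc
  obtain ⟨J, hJA, hJc, hJ⟩ := hX (Clopens X) (fun a => (a : Set X)) A hc (fun a ha =>
    ⟨a.isClopen.2, nonempty_iff_ne_empty.2 fun h => hA a ha (SetLike.coe_injective h)⟩)
  have hJs : ¬ J.Subsingleton := fun h => hJc h.countable
  obtain ⟨a, ha, b, hb, hab⟩ := not_subsingleton_iff.1 hJs
  obtain ⟨x, hxa, hxb⟩ := hJ a ha b hb
  have hbot : x ∈ ((a ⊓ b : Clopens X) : Set X) := ⟨hxa, hxb⟩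
  rw [(hdis (hJA ha) (hJA hb) hab).eq_bot] at hbot
  exact hbot

theorem exists_ultrafilter_of_point (x : X) :
    ∃ D : Order.PFilter (Clopens X), IsBAUltrafilter D ∧ ∀ a, a ∈ D ↔ x ∈ a := by
  have hF : Order.IsPFilter {a : Clopens X | x ∈ a} := by
    refine Order.IsPFilter.of_def ⟨⊤, mem_univ x⟩ ?_ fun {a b} hab ha => hab ha
    exact fun a ha b hb => ⟨a ⊓ b, ⟨ha, hb⟩, inf_le_left, inf_le_right⟩
  refine ⟨hF.toPFilter, ⟨fun h : x ∈ (⊥ : Clopens X) => h, ?_⟩, fun a => Iff.rfl⟩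
  intro G hG hle a ha
  by_contra hxa
  have hac : aᶜ ∈ G := hle (show x ∈ aᶜ from hxa)
  exact hG (by simpa using Order.PFilter.inf_mem ha hac)

/-- Compactness: the members form a downward directed family of nonempty closed sets. -/
theorem exists_mem_of_pfilter [CompactSpace X] (D : Order.PFilter (Clopens X)) (hD : ⊥ ∉ D) :
    ∃ x, ∀ a ∈ D, x ∈ a := by
  have : Nonempty {a // a ∈ D} := D.nonempty.to_subtype
  obtain ⟨x, hx⟩ := IsCompact.nonempty_iInter_of_directed_nonempty_isCompact_isClosed
    (fun a : {a // a ∈ D} => (a.1 : Set X))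
    (fun a b => ⟨⟨a.1 ⊓ b.1, Order.PFilter.inf_mem a.2 b.2⟩, inter_subset_left,
      inter_subset_right⟩)
    (fun a => nonempty_iff_ne_empty.2 fun h => hD (by
      rw [← show a.1 = ⊥ from SetLike.coe_injective h]; exact a.2))
    (fun a => a.1.isClopen.1.isCompact) (fun a => a.1.isClopen.1)
  exact ⟨x, fun a ha => mem_iInter.1 hx ⟨a, ha⟩⟩

theorem Dense.coveredByUltrafilters {D : Set X} (hD : Dense D) :
    CoveredByUltrafilters (Clopens X) #D := by
  choose U hU hmem using exists_ultrafilter_of_point (X := X)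
  refine ⟨D, fun x => U x, rfl, fun x => hU x, ?_⟩
  ext b
  simp only [mem_iUnion, SetLike.mem_coe, hmem, mem_ofPred_eq]
  constructor
  · rintro ⟨x, hx⟩ rfl
    exact hx
  · intro hb
    obtain ⟨y, hy, hyD⟩ := hD.inter_open_nonempty _ b.isClopen.2
      (nonempty_iff_ne_empty.2 fun h => hb (SetLike.coe_injective h))
    exact ⟨⟨y, hyD⟩, hy⟩

/-- Take a common point of the members of each ultrafilter. A nonempty clopen set missing all these
points would belong to none of the ultrafilters. -/
theorem CoveredByUltrafilters.exists_dense [CompactSpace X] [T2Space X]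
    [TotallyDisconnectedSpace X] {κ : Cardinal.{u}} (h : CoveredByUltrafilters (Clopens X) κ) :
    ∃ D : Set X, #D ≤ κ ∧ Dense D := by
  obtain ⟨ι, U, rfl, hU, hcov⟩ := h
  choose x hx using fun i => exists_mem_of_pfilter (U i) (hU i).prop
  refine ⟨range x, Cardinal.mk_range_le, ?_⟩
  by_contra hd
  obtain ⟨a, ha⟩ := exists_clopen_avoiding hd
  have hne : a.1 ∈ {b : Clopens X | b ≠ ⊥} := by
    intro h
    have := a.2
    rw [h] at this
    exact this.ne_empty rfl
  rw [← hcov] at hne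
  obtain ⟨i, hi⟩ := mem_iUnion.1 hne
  exact ha _ (mem_range_self i) (hx i _ hi)

end Clopens

theorem theorem1p1 (μ : Cardinal.{u}) (hμ : Cardinal.aleph0 < μ) :
    ∃ (B : Type u) (_ : BooleanAlgebra B),
      BACountableChainCondition B ∧ topologicalDensity B = μ := by
  obtain ⟨X, _, _, _, _, _, hK, ⟨D, hDle, hD⟩, hX⟩ := hasStoneSpaceOfDensity μ hμ.le
  have hcov := hD.coveredByUltrafilters
  rw [hDle.antisymm (hX D hD)] at hcov
  refine ⟨Clopens X, inferInstance, hK.countableChainCondition, le_antisymm (csInf_le' hcov) ?_⟩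
  refine le_csInf ⟨μ, hcov⟩ fun κ hκ => ?_
  obtain ⟨E, hE, hEd⟩ := CoveredByUltrafilters.exists_dense hκ
  exact (hX E hEd).trans hE
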